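/- A coloured graph is a finite simple undirected graph $G$ together with a colouring $\lambda_G\colon V(G)\to C$, where $C$ is a finite set; its colour classes are the sets $\lambda_G^{-1}(c)$, $c\in C$. Isomorphisms of coloured graphs preserve the colours. For coloured graphs $G,H$ with $|V(G)|=|V(H)|$, the edit distance $\delta_{\mathsf{edit}}(G,H)$ is the minimum of $|E(G)^\pi\,\triangle\,E(H)|$ over all colour-preserving bijections $\pi\colon V(G)\to V(H)$, where $E(G)^\pi=\{\{\pi(v),\pi(w)\} : \{v,w\}\in E(G)\}$. The VC dimension of $G$ is the maximum cardinality of a set $X\subseteq V(G)$ such that every subset of $X$ has the form $N_G(v)\cap X$ for some $v\in V(G)$. For $k\ge 1$, the $k$-dimensional Weisfeiler–Leman algorithm ($k$-WL) colours the $k$-tuples of vertices in rounds $i=0,1,2,\dots$. The round-$0$ colour of $(v_1,\dots,v_k)$ records, for all $a,b\in\{1,\dots,k\}$, whether $v_a=v_b$, whether $v_av_b\in E(G)$, and the colour of $v_a$. The round-$(i+1)$ colour of $\bar v$ is the pair consisting of its round-$i$ colour and of the multiset, over all $w\in V(G)$ if $k\ge 2$ and over all neighbours $w$ of $v_1$ if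 $k=1$, of the $k$-tuples whose $j$-th entry is the round-$i$ colour of $\bar v$ with its $j$-th entry replaced by $w$. The algorithm distinguishes $G$ and $H$ if in some round some colour occurs a different number of times in $G$ and in $H$. **Theorem.** There are absolute constants $c_1,c_2>0$ such that for all integers $k\ge 1$ and $n\ge k$ there are non-isomorphic coloured graphs $G,H$ such that - $|V(G)|=|V(H)|$ and $c_1 n\le |V(G)|\le c_2 n$, - $k$-WL does not distinguish $G$ and $H$, - $\delta_{\mathsf{edit}}(G,H)\ge \dfrac{n^2}{k^2}$, - $G$ and $H$ have VC dimension at most $3$, and - each colour class of $G$ and of $H$ has size at most $4$. -/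

import Mathlib

open scoped symmDiff

/-- A coloured graph: a simple graph on `V` with a vertex colouring by elements of `C`. -/
structure ColouredGraph (V C : Type*) where
  graph : SimpleGraph V
  colour : V → C

namespace ColouredGraph

section General

variable {V W C : Type*}

/-- Isomorphism of coloured graphs: a graph isomorphism that preserves the colours. -/
def Isomorphic (G : ColouredGraph V C) (H : ColouredGraph W C) : Prop :=
  ∃ φ : G.graph ≃g H.graph, ∀ v, H.colour (φ v) = G.colour v

/-- The edit cost `|E(G)^π ∆ E(H)|` of a bijection `π : V(G) → V(H)`. -/
noncomputable def editCost (G : ColouredGraph V C) (H : ColouredGraph W C) (π : V ≃ W) : ℕ :=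
  ((Sym2.map π '' G.graph.edgeSet) ∆ H.graph.edgeSet).ncard

/-- The edit distance of coloured graphs: the minimum edit cost of a colour-preserving
bijection. (If there is no such bijection, the value is `0`, so that a positive lower bound on
`editDist` includes the existence of one.) -/
noncomputable def editDist (G : ColouredGraph V C) (H : ColouredGraph W C) : ℕ :=
  sInf {m | ∃ π : V ≃ W, (∀ v, H.colour (π v) = G.colour v) ∧ m = editCost G H π}

/-- The colour class of the colour `c`. -/
def colourClass (G : ColouredGraph V C) (c : C) : Set V :=
  {v | G.colour v = c}

end General

open Classical in
/-- The VC dimension of a graph: the VC dimension of the set system `{N_G(v) | v ∈ V(G)}`. -/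
noncomputable def vcDim {V C : Type*} [Fintype V] (G : ColouredGraph V C) : ℕ :=
  (Finset.univ.image fun v : V => G.graph.neighborFinset v).vcDim

universe u v

/-- The colours used in round `i` of the `k`-dimensional Weisfeiler-Leman algorithm on graphs
coloured by `C`. In round `0` a colour is the isomorphism type of a coloured ordered subgraph on
`k` (not necessarily distinct) vertices, given by its equality relation, its adjacency relation
and its vertex colours. In round `i + 1` it is a pair of a colour of round `i` and a multiset of
`k`-tuples of colours of round `i`. The type does not depend on the graph, so that
the colours of tuples of different graphs can be compared. -/
def WLColour (k : ℕ) (C : Type u) : ℕ → Type u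
  | 0 => (Fin k → Fin k → Prop) × (Fin k → Fin k → Prop) × (Fin k → C)
  | i + 1 => WLColour k C i × Multiset (Fin k → WLColour k C i)

open Classical in
/-- The vertices over which the multiset in one refinement step of `k`-WL ranges: all vertices
if `k ≥ 2`, the neighbours of the single vertex of the tuple if `k = 1`. -/
noncomputable def wlRange {V : Type v} {C : Type u} [Fintype V] (G : ColouredGraph V C) (k : ℕ)
    (x : Fin k → V) : Finset V :=
  if k = 1 then Finset.univ.filter fun w => ∀ j, G.graph.Adj (x j) w else Finset.univ

/-- The colouring of `k`-tuples of vertices in round `i` of `k`-WL. Here `Function.update x j w`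
is the tuple `x` with its `j`-th entry replaced by `w`. -/
noncomputable def wl {V : Type v} {C : Type u} [Fintype V] (G : ColouredGraph V C) (k : ℕ) :
    (i : ℕ) → (Fin k → V) → WLColour k C i
  | 0, x => (fun a b => x a = x b, fun a b => G.graph.Adj (x a) (x b), fun a => G.colour (x a))
  | i + 1, x =>
      (G.wl k i x,
        (G.wlRange k x).val.map fun w => fun j => G.wl k i (Function.update x j w))

/-- `k`-WL distinguishes `G` and `H` if in some round some colour is given to different numbers
of `k`-tuples of `G` and of `H`. -/
def WLDistinguishes {V W : Type v} {C : Type u} [Fintype V] [Fintype W] (k : ℕ)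
    (G : ColouredGraph V C) (H : ColouredGraph W C) : Prop :=
  ∃ (i : ℕ) (c : WLColour k C i),
    {x : Fin k → V | G.wl k i x = c}.ncard ≠ {y : Fin k → W | H.wl k i y = c}.ncard

end ColouredGraph

/-! `G` and `H` are Cai-Fürer-Immerman graphs over a base graph `B` of maximum degree 3 with O(k)
vertices, each vertex repeated as t ≈ n/k twins of different colours. All charges of `G` are 0; `H`
has a single charge 1, at `r₀`.

Edit distance: one copy of the zero vertex over every base vertex gives a copy of `B` in `G`. If a
colour-preserving bijection kept all its edges, the values of the images would be symmetric and sum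
to 0, against the total charge 1. So each of the t^|U| transversals contains a broken edge. Since a
broken edge lies in at most t^(|U|-2) of them, at least t² edges are broken (`le_editCost_cfi`).

Weisfeiler-Leman: shifting along a flow from `r₀` to `r` makes the graphs agree except over `r`. A
robber who evades k+1 cops in `B` keeps `r` away from the bases of a k-tuple and of one further
vertex, which is all that a refinement step sees (`Haven.Similar.wl_eq`).

The base graph: by counting, some function of out-degree 20 on 4(k+1) points has an arc between any
two quarters of the points. After deletion of at most a quarter, a unique giant component, the core,
survives, and the robber stays in it. Replacing points by paths of half-edges reduces the degree to
3. Two of the at most three values at a CFI vertex then determine the third, which bounds the colour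
classes and the VC dimension. -/

/-! ### Expanding functions by counting -/

/-- A function all of whose large sets `A`, `B` are joined by an arc from `A` to `B`. -/
theorem exists_expanding (M : Type) [Fintype M] [DecidableEq M] [Nonempty M] :
    ∃ f : M × Fin 20 → M, ∀ A B : Finset M, Fintype.card M ≤ 4 * A.card →
      Fintype.card M ≤ 4 * B.card → ∃ a ∈ A, ∃ i, f (a, i) ∈ B := by
  classical
  by_contra hcon
  push Not at hcon
  set m := Fintype.card M with hm
  have hm0 : 0 < m := Fintype.card_pos
  let large : Finset (Finset M × Finset M) :=
    Finset.univ.filter fun p => m ≤ 4 * p.1.card ∧ m ≤ 4 * p.2.card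
  let avoid : Finset M × Finset M → Finset (M × Fin 20 → M) := fun p =>
    Fintype.piFinset fun x => if x.1 ∈ p.1 then p.2ᶜ else Finset.univ
  have hcover : (Finset.univ : Finset (M × Fin 20 → M)) ⊆ large.biUnion avoid := by
    intro f _
    obtain ⟨A, B, hA, hB, h⟩ := hcon f
    refine Finset.mem_biUnion.2 ⟨(A, B), by simp [large, hA, hB], ?_⟩
    refine Fintype.mem_piFinset.2 fun x => ?_
    by_cases hx : x.1 ∈ A
    · simpa [hx] using h x.1 hx x.2
    · simp [hx]
  -- Each of the 20|A| ≥ 5m arcs leaving A avoids B with probability at most 3/4, and (3/4)^5 =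
  -- 243/1024. As there are at most 4^m pairs and 4 · 243/1024 < 1, a union bound suffices.
  have havoid : ∀ p ∈ large, ((avoid p).card : ℝ) ≤ (243 / 1024 : ℝ) ^ m * (m : ℝ) ^ (m * 20) := by
    intro p hp
    obtain ⟨hA, hB⟩ := (Finset.mem_filter.1 hp).2
    have hcard : ((avoid p).card : ℝ)
        = ((p.2ᶜ.card : ℝ) ^ (p.1.card * 20)) * (m : ℝ) ^ ((m - p.1.card) * 20) := by
      let g : M → ℕ := fun a => if a ∈ p.1 then p.2ᶜ.card else m
      have h1 : (avoid p).card = ∏ x : M × Fin 20, g x.1 := by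
        rw [Fintype.card_piFinset]
        refine Finset.prod_congr rfl fun x _ => ?_
        simp only [g]
        split_ifs <;> simp [hm]
      rw [h1, Fintype.prod_prod_type]
      simp only [Finset.prod_const, Finset.card_univ, Fintype.card_fin]
      rw [Finset.prod_pow, Finset.prod_ite]
      simp only [Finset.prod_const, Finset.filter_mem_eq_inter, Finset.univ_inter]
      have h2 : (Finset.univ.filter fun x => x ∉ p.1).card = m - p.1.card := by
        rw [Finset.filter_notMem_eq_sdiff, ← Finset.compl_eq_univ_sdiff, Finset.card_compl]
      rw [h2]
      push_cast
      rw [mul_pow, ← pow_mul, ← pow_mul]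
    have hle : p.1.card ≤ m := Finset.card_le_univ _
    have hc : (p.2ᶜ.card : ℝ) ≤ 3 / 4 * m := by
      rw [Finset.card_compl, Nat.cast_sub (Finset.card_le_univ _)]
      have : (m : ℝ) ≤ 4 * p.2.card := by exact_mod_cast hB
      linarith
    calc ((avoid p).card : ℝ)
        ≤ (3 / 4 * (m : ℝ)) ^ (p.1.card * 20) * (m : ℝ) ^ ((m - p.1.card) * 20) := by
          rw [hcard]; gcongr
      _ = (3 / 4 : ℝ) ^ (p.1.card * 20) * (m : ℝ) ^ (m * 20) := by
          rw [mul_pow, mul_assoc, ← pow_add, ← add_mul, Nat.add_sub_cancel' hle]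
      _ ≤ (3 / 4 : ℝ) ^ (5 * m) * (m : ℝ) ^ (m * 20) := by
          gcongr ?_ * _
          exact pow_le_pow_of_le_one (by norm_num) (by norm_num) (by omega)
      _ = _ := by rw [pow_mul]; norm_num
  have hlarge : (large.card : ℝ) ≤ 4 ^ m := by
    have h1 : large.card ≤ Fintype.card (Finset M × Finset M) := Finset.card_le_univ _
    rw [Fintype.card_prod, Fintype.card_finset, ← mul_pow] at h1
    exact_mod_cast h1
  have htotal : ((m : ℝ) ^ (m * 20)) ≤ 4 ^ m * ((243 / 1024 : ℝ) ^ m * (m : ℝ) ^ (m * 20)) := by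
    have h1 := (Finset.card_le_card hcover).trans Finset.card_biUnion_le
    have h2 : Fintype.card (M × Fin 20 → M) = m ^ (m * 20) := by simp [hm]
    rw [Finset.card_univ, h2] at h1
    have h3 : ((m : ℝ) ^ (m * 20)) ≤ ∑ p ∈ large, ((avoid p).card : ℝ) := by exact_mod_cast h1
    refine (h3.trans (Finset.sum_le_sum havoid)).trans ?_
    rw [Finset.sum_const, nsmul_eq_mul]
    gcongr
  have hpos : (0 : ℝ) < (m : ℝ) ^ (m * 20) := by positivity
  have hlt : (4 : ℝ) ^ m * (243 / 1024) ^ m < 1 := by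
    rw [← mul_pow]
    exact pow_lt_one₀ (by norm_num) (by norm_num) hm0.ne'
  nlinarith

/-! ### The giant component after deletion of few vertices -/

section Core

variable {M : Type} [DecidableEq M]

/-- `A` is a union of components of the graph with adjacency `r` after removal of `P`. -/
def ClosedOff (r : M → M → Prop) (P A : Finset M) : Prop :=
  Disjoint A P ∧ ∀ a ∈ A, ∀ b, b ∉ P → b ∉ A → ¬ r a b ∧ ¬ r b a

variable {r : M → M → Prop} {P Q A B : Finset M}

theorem ClosedOff.inter (hA : ClosedOff r P A) (hB : ClosedOff r P B) :
    ClosedOff r P (A ∩ B) := by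
  refine ⟨hA.1.mono_left Finset.inter_subset_left, fun a ha b hbP hb => ?_⟩
  rw [Finset.mem_inter] at ha hb
  by_cases h : b ∈ A
  · exact hB.2 a ha.2 b hbP fun h' => hb ⟨h, h'⟩
  · exact hA.2 a ha.1 b hbP h

theorem ClosedOff.sdiff (hA : ClosedOff r P A) (hB : ClosedOff r P B) :
    ClosedOff r P (A \ B) := by
  refine ⟨hA.1.mono_left Finset.sdiff_subset, fun a ha b hbP hb => ?_⟩
  rw [Finset.mem_sdiff] at ha hb
  by_cases h : b ∈ A
  · have hbB : b ∈ B := by by_contra h'; exact hb ⟨h, h'⟩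
    exact (hB.2 b hbB a (Finset.disjoint_left.1 hA.1 ha.1) ha.2).symm
  · exact hA.2 a ha.1 b hbP h

theorem ClosedOff.sdiff_of_subset (hA : ClosedOff r P A) (hPQ : P ⊆ Q) :
    ClosedOff r Q (A \ Q) := by
  refine ⟨Finset.sdiff_disjoint, fun a ha b hbQ hb => ?_⟩
  rw [Finset.mem_sdiff] at ha hb
  exact hA.2 a ha.1 b (fun h => hbQ (hPQ h)) fun h => hb ⟨h, hbQ⟩

variable [Fintype M]

/-- Any two sets that contain at least a quarter of all vertices are joined by an arc. -/
def Spreads (r : M → M → Prop) : Prop :=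
  ∀ A B : Finset M, Fintype.card M ≤ 4 * A.card → Fintype.card M ≤ 4 * B.card →
    ∃ a ∈ A, ∃ b ∈ B, r a b

/-- No arc leads from `A` to the rest of the complement of `P`, so that rest is less than a quarter,
as `P` is at most a quarter: no union of components has between a quarter and a half of all
vertices. -/
theorem ClosedOff.card_gt (hr : Spreads r) (hP : 4 * P.card ≤ Fintype.card M)
    (hA : ClosedOff r P A) (hc : Fintype.card M ≤ 4 * A.card) :
    Fintype.card M < 2 * A.card := by
  have h1 : 4 * (Pᶜ \ A).card < Fintype.card M := by
    by_contra! h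
    obtain ⟨a, ha, b, hb, hab⟩ := hr A _ hc h
    simp only [Finset.mem_sdiff, Finset.mem_compl] at hb
    exact (hA.2 a ha b hb.1 hb.2).1 hab
  have h2 : A ⊆ Pᶜ := fun x hx => by simpa using Finset.disjoint_left.1 hA.1 hx
  have h3 := Finset.card_sdiff_add_card_eq_card h2
  rw [Finset.card_compl] at h3
  omega

open Classical in
/-- The intersection of all unions of components outside `P` that contain at least a quarter of
all vertices. -/
noncomputable def core (r : M → M → Prop) (P : Finset M) : Finset M :=
  Finset.univ.filter fun x =>
    ∀ A, ClosedOff r P A → Fintype.card M ≤ 4 * A.card → x ∈ A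

theorem core_subset (hA : ClosedOff r P A) (hc : Fintype.card M ≤ 4 * A.card) :
    core r P ⊆ A := fun x hx => by
  classical
  exact (Finset.mem_filter.1 hx).2 A hA hc

/-- Large unions of components are closed under intersection: `A \ B` has no arc to `B`, so it is
less than a quarter, while `A` is more than a half. Hence a smallest one lies in all others. -/
theorem core_closedOff (hr : Spreads r) (hP : 4 * P.card ≤ Fintype.card M) :
    ClosedOff r P (core r P) ∧ Fintype.card M ≤ 4 * (core r P).card := by
  classical
  let L : Finset (Finset M) :=
    Finset.univ.filter fun A => ClosedOff r P A ∧ Fintype.card M ≤ 4 * A.card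
  have hL : L.Nonempty := by
    refine ⟨Pᶜ, Finset.mem_filter.2 ⟨Finset.mem_univ _, ⟨disjoint_compl_left, ?_⟩, ?_⟩⟩
    · intro a _ b hb hb'
      simp [hb] at hb'
    · rw [Finset.card_compl]; omega
  obtain ⟨A, hA, hmin⟩ := Finset.exists_min_image L Finset.card hL
  obtain ⟨hA1, hA2⟩ := (Finset.mem_filter.1 hA).2
  have hcore : core r P = A := by
    refine (core_subset hA1 hA2).antisymm fun x hx => ?_
    refine Finset.mem_filter.2 ⟨Finset.mem_univ _, fun B hB hc => ?_⟩
    have h1 := hA1.card_gt hr hP hA2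
    have h3 : Fintype.card M ≤ 4 * (A ∩ B).card := by
      have h3 : 4 * (A \ B).card < Fintype.card M := by
        by_contra! h
        obtain ⟨a, ha, b, hb, hab⟩ := hr _ B h hc
        rw [Finset.mem_sdiff] at ha
        exact (hB.2 b hb a (Finset.disjoint_left.1 hA1.1 ha.1) ha.2).2 hab
      have h4 := Finset.card_sdiff_add_card_inter A B
      omega
    have h4 := hmin _ (Finset.mem_filter.2 ⟨Finset.mem_univ _, hA1.inter hB, h3⟩)
    have h5 := Finset.eq_of_subset_of_card_le Finset.inter_subset_left h4
    exact (Finset.mem_inter.1 (h5 ▸ hx)).2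
  exact hcore ▸ ⟨hA1, hA2⟩

theorem core_antitone (hr : Spreads r) (hPQ : P ⊆ Q) (hQ : 4 * Q.card ≤ Fintype.card M) :
    core r Q ⊆ core r P := by
  have hP : 4 * P.card ≤ Fintype.card M := by
    have := Finset.card_le_card hPQ
    omega
  obtain ⟨h1, h2⟩ := core_closedOff hr hP
  refine (core_subset (h1.sdiff_of_subset hPQ) ?_).trans Finset.sdiff_subset
  have h3 := h1.card_gt hr hP h2
  have h4 := Finset.le_card_sdiff Q (core r P)
  omega

/-- The core is connected: if a small union of components split off, the rest would still be large
and would have to contain the core. -/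
theorem core_eq_of_closedOff (hr : Spreads r) (hP : 4 * P.card ≤ Fintype.card M)
    (hA : ClosedOff r P A) (hsub : A ⊆ core r P) (hne : A.Nonempty) : A = core r P := by
  obtain ⟨h1, h2⟩ := core_closedOff hr hP
  by_cases hc : Fintype.card M ≤ 4 * A.card
  · exact hsub.antisymm (core_subset hA hc)
  · have h3 := h1.card_gt hr hP h2
    have h4 := Finset.card_sdiff_add_card_eq_card hsub
    have h5 := core_subset (h1.sdiff hA) (by omega)
    obtain ⟨a, ha⟩ := hne
    exact absurd ha (Finset.mem_sdiff.1 (h5 (hsub ha))).2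

end Core

/-! ### Flows modulo 2 and havens -/

section Linked

variable {U : Type}

/-- A symmetric `ZMod 2`-valued function on the edges of `B`. -/
def IsEdgeFunction (B : SimpleGraph U) (φ : U → U → ZMod 2) : Prop :=
  (∀ u v, φ u v = φ v u) ∧ ∀ u v, φ u v ≠ 0 → B.Adj u v

theorem IsEdgeFunction.add {B : SimpleGraph U} {φ ψ : U → U → ZMod 2} (hφ : IsEdgeFunction B φ)
    (hψ : IsEdgeFunction B ψ) : IsEdgeFunction B (φ + ψ) := by
  refine ⟨fun u v => by simp [hφ.1 u v, hψ.1 u v], fun u v h => ?_⟩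
  by_contra hB
  have h1 : φ u v = 0 := by_contra fun h => hB (hφ.2 u v h)
  have h2 : ψ u v = 0 := by_contra fun h => hB (hψ.2 u v h)
  simp [h1, h2] at h

variable [Fintype U] [DecidableEq U]

/-- There is a `ZMod 2`-flow from `r` to `s` on the edges of `B` inside `D`. -/
def Linked (B : SimpleGraph U) (D : Set U) (r s : U) : Prop :=
  ∃ φ : U → U → ZMod 2, IsEdgeFunction B φ ∧ (∀ u v, φ u v ≠ 0 → u ∈ D) ∧
    ∀ u, ∑ v, φ u v = (Pi.single r 1 + Pi.single s 1 : U → ZMod 2) u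

variable {B : SimpleGraph U} {D : Set U} {r s q : U}

theorem Linked.refl (B : SimpleGraph U) (D : Set U) (r : U) : Linked B D r r :=
  ⟨0, ⟨by simp, by simp⟩, by simp, fun u => by simp [CharTwo.add_self_eq_zero]⟩

theorem Linked.symm (h : Linked B D r s) : Linked B D s r := by
  obtain ⟨φ, h1, h2, h3⟩ := h
  exact ⟨φ, h1, h2, fun u => by rw [h3, add_comm]⟩

theorem Linked.trans (h : Linked B D r s) (h' : Linked B D s q) : Linked B D r q := by
  obtain ⟨φ, h1, h2, h3⟩ := h
  obtain ⟨ψ, k1, k2, k3⟩ := h'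
  refine ⟨φ + ψ, h1.add k1, fun u v huv => ?_, fun u => ?_⟩
  · by_contra hD
    have e1 : φ u v = 0 := by_contra fun h => hD (h2 u v h)
    have e2 : ψ u v = 0 := by_contra fun h => hD (k2 u v h)
    simp [e1, e2] at huv
  · simp only [Pi.add_apply, Finset.sum_add_distrib, h3, k3]
    linear_combination CharTwo.add_self_eq_zero ((Pi.single s 1 : U → ZMod 2) u)

theorem Linked.of_adj (h : B.Adj r s) (hr : r ∈ D) (hs : s ∈ D) : Linked B D r s := by
  have hne := h.ne
  refine ⟨fun u v => if (u = r ∧ v = s) ∨ (u = s ∧ v = r) then 1 else 0,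
    ⟨fun u v => ?_, fun u v huv => ?_⟩, fun u v huv => ?_, fun u => ?_⟩
  · exact if_congr (by tauto) rfl rfl
  · have : (u = r ∧ v = s) ∨ (u = s ∧ v = r) := by grind
    rcases this with ⟨rfl, rfl⟩ | ⟨rfl, rfl⟩
    · exact h
    · exact h.symm
  · grind
  · by_cases hu : u = r
    · subst hu
      simp [hne]
    · by_cases hu' : u = s
      · subst hu'
        simp [hne.symm]
      · simp [hu, hu']

end Linked

/-- A haven of order `k` in `B`: a strategy for a robber against `k` cops, where the robber moves
inside the sets `region P`. -/
structure Haven {U : Type} [Fintype U] [DecidableEq U] (B : SimpleGraph U) (k : ℕ) where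
  region : Finset U → Set U
  nonempty : ∀ P, P.card ≤ k → (region P).Nonempty
  notMem : ∀ P, P.card ≤ k → ∀ u ∈ region P, u ∉ P
  antitone : ∀ P Q, P ⊆ Q → Q.card ≤ k → region Q ⊆ region P
  linked : ∀ P, P.card ≤ k → ∀ r ∈ region P, ∀ s ∈ region P, Linked B (region P) r s

/-! ### Reduction to degree 3 by half-edges -/

/-- Positions within the fibres of a map. -/
theorem exists_fibre_index {U M : Type} [Fintype U] (b : U → M) :
    ∃ idx : U → ℕ, (∀ u v, b u = b v → idx u = idx v → u = v) ∧
      ∀ u, idx u ≠ 0 → ∃ v, b v = b u ∧ idx v + 1 = idx u := by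
  classical
  let e : ∀ x : M, {u // b u = x} ≃ Fin (Fintype.card {u // b u = x}) :=
    fun x => Fintype.equivFin _
  refine ⟨fun u => (e (b u) ⟨u, rfl⟩).val, fun u v huv h => ?_, fun u hu => ?_⟩
  · have key : ∀ (x y : M) (hx : b u = x) (hy : b v = y), x = y →
        (e x ⟨u, hx⟩).val = (e y ⟨v, hy⟩).val → u = v := by
      rintro x _ hx hy rfl h
      exact congrArg Subtype.val ((e x).injective (Fin.ext h))
    exact key _ _ rfl rfl huv h
  · have hlt := (e (b u) ⟨u, rfl⟩).isLt
    let w := (e (b u)).symm ⟨(e (b u) ⟨u, rfl⟩).val - 1, by omega⟩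
    have key : ∀ (x : M) (hx : b w.val = x), x = b u →
        (e x ⟨w.val, hx⟩).val = (e (b u) ⟨u, rfl⟩).val - 1 := by
      rintro _ hx rfl
      have : (⟨w.val, hx⟩ : {v // b v = b u}) = w := rfl
      rw [this]
      simp [w]
    refine ⟨w.val, w.prop, ?_⟩
    dsimp only at hu ⊢
    rw [key _ rfl w.prop]
    omega

section HalfEdge

variable {M : Type} [Fintype M] [DecidableEq M]

/-- The vertex to which a half-edge of the graph with arcs `(a, f (a, i))` is attached. -/
def attach (f : M × Fin 20 → M) (h : (M × Fin 20) × Bool) : M :=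
  if h.2 then f h.1 else h.1.1

/-- The graph obtained by replacing every vertex by a path through its half-edges. -/
def halfEdgeGraph (f : M × Fin 20 → M) (idx : (M × Fin 20) × Bool → ℕ) :
    SimpleGraph ((M × Fin 20) × Bool) where
  Adj g h := h = (g.1, !g.2) ∨
    attach f g = attach f h ∧ (idx g + 1 = idx h ∨ idx h + 1 = idx g)
  symm := ⟨fun g h hgh => by
    rcases hgh with rfl | ⟨h1, h2⟩
    · simp
    · exact .inr ⟨h1.symm, h2.symm⟩⟩
  loopless := ⟨fun g hg => by
    rcases hg with h | ⟨-, h⟩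
    · simpa using congrArg Prod.snd h
    · omega⟩

variable {f : M × Fin 20 → M} {idx : (M × Fin 20) × Bool → ℕ}

theorem halfEdgeGraph_degree (h1 : ∀ u v, attach f u = attach f v → idx u = idx v → u = v)
    (u : (M × Fin 20) × Bool) :
    ∃ p q s, ∀ v, (halfEdgeGraph f idx).Adj u v → v = p ∨ v = q ∨ v = s := by
  classical
  refine ⟨(u.1, !u.2),
    if h : ∃ v, attach f u = attach f v ∧ idx u + 1 = idx v then h.choose else u,
    if h : ∃ v, attach f u = attach f v ∧ idx v + 1 = idx u then h.choose else u, fun v hv => ?_⟩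
  rcases hv with rfl | ⟨ha, hi | hi⟩
  · exact .inl rfl
  · have h : ∃ v, attach f u = attach f v ∧ idx u + 1 = idx v := ⟨v, ha, hi⟩
    rw [dif_pos h]
    exact .inr (.inl (h1 _ _ (ha.symm.trans h.choose_spec.1) (hi.symm.trans h.choose_spec.2)))
  · have h : ∃ v, attach f u = attach f v ∧ idx v + 1 = idx u := ⟨v, ha, hi⟩
    rw [dif_pos h]
    exact .inr (.inr (h1 _ _ (ha.symm.trans h.choose_spec.1)
      (by have := h.choose_spec.2; omega)))

theorem linked_of_attach_eq (h1 : ∀ u v, attach f u = attach f v → idx u = idx v → u = v)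
    (h2 : ∀ u, idx u ≠ 0 → ∃ v, attach f v = attach f u ∧ idx v + 1 = idx u)
    {S : Set M} {u v : (M × Fin 20) × Bool} (huv : attach f u = attach f v)
    (hu : attach f u ∈ S) : Linked (halfEdgeGraph f idx) (attach f ⁻¹' S) u v := by
  have key : ∀ n u, idx u = n → attach f u ∈ S → ∃ z, attach f z = attach f u ∧ idx z = 0 ∧
      Linked (halfEdgeGraph f idx) (attach f ⁻¹' S) u z := by
    intro n
    induction n with
    | zero => exact fun u hn _ => ⟨u, rfl, hn, Linked.refl _ _ _⟩
    | succ n ih =>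
      intro u hn hu
      obtain ⟨w, hw, hw'⟩ := h2 u (by omega)
      obtain ⟨z, hz, hz0, hlink⟩ := ih w (by omega) (hw ▸ hu)
      have hadj : (halfEdgeGraph f idx).Adj u w := Or.inr ⟨hw.symm, Or.inr hw'⟩
      have hwS : attach f w ∈ S := hw ▸ hu
      have huw : Linked (halfEdgeGraph f idx) (attach f ⁻¹' S) u w := Linked.of_adj hadj hu hwS
      exact ⟨z, hz.trans hw, hz0, huw.trans hlink⟩
  obtain ⟨z, hz, hz0, hl⟩ := key _ u rfl hu
  obtain ⟨z', hz', hz0', hl'⟩ := key _ v rfl (huv ▸ hu)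
  obtain rfl : z = z' := h1 _ _ (hz.trans (huv.trans hz'.symm)) (hz0.trans hz0'.symm)
  exact hl.trans hl'.symm

/-- The arcs of the graph given by `f`. -/
def Arc (f : M × Fin 20 → M) (a b : M) : Prop := ∃ i, f (a, i) = b

/-- If the graph with arcs `(a, f (a, i))` spreads, then its half-edge graph has a haven. -/
noncomputable def halfEdgeHaven (hr : Spreads (Arc f))
    (h1 : ∀ u v, attach f u = attach f v → idx u = idx v → u = v)
    (h2 : ∀ u, idx u ≠ 0 → ∃ v, attach f v = attach f u ∧ idx v + 1 = idx u)
    {k : ℕ} (hk : 4 * k ≤ Fintype.card M) (hM : 0 < Fintype.card M) :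
    Haven (halfEdgeGraph f idx) k where
  region P := attach f ⁻¹' (core (Arc f) (P.image (attach f)))
  nonempty P hP := by
    have hc : 4 * (P.image (attach f)).card ≤ Fintype.card M := by
      have := Finset.card_image_le (s := P) (f := attach f)
      omega
    have h := (core_closedOff hr hc).2
    obtain ⟨a, ha⟩ : (core (Arc f) (P.image (attach f))).Nonempty := by
      rw [← Finset.card_pos]; omega
    exact ⟨((a, 0), false), ha⟩
  notMem P hP u hu huP := by
    have hc : 4 * (P.image (attach f)).card ≤ Fintype.card M := by
      have := Finset.card_image_le (s := P) (f := attach f)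
      omega
    exact Finset.disjoint_left.1 (core_closedOff hr hc).1.1 hu (Finset.mem_image_of_mem _ huP)
  antitone P Q hPQ hQ u hu := by
    have hc : 4 * (Q.image (attach f)).card ≤ Fintype.card M := by
      have := Finset.card_image_le (s := Q) (f := attach f)
      omega
    exact core_antitone hr (Finset.image_subset_image hPQ) hc hu
  linked P hP u hu v hv := by
    classical
    have hc : 4 * (P.image (attach f)).card ≤ Fintype.card M := by
      have := Finset.card_image_le (s := P) (f := attach f)
      omega
    set K := core (Arc f) (P.image (attach f)) with hK
    -- The part of the core that can be reached from `u`. It is a union of components, hence the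
    -- whole core.
    let A : Finset M := K.filter fun a => ∃ w, attach f w = a ∧
      Linked (halfEdgeGraph f idx) (attach f ⁻¹' K) u w
    obtain ⟨hcl, -⟩ := core_closedOff hr hc
    have hstep : ∀ w w', attach f w ∈ A → attach f w' ∈ K → w' = (w.1, !w.2) →
        attach f w' ∈ A := by
      intro w w' hw hw' hadj
      obtain ⟨hwK, z, hz, hl⟩ := Finset.mem_filter.1 hw
      exact Finset.mem_filter.2 ⟨hw', w', rfl,
        (hl.trans (linked_of_attach_eq h1 h2 hz (by rw [hz]; exact hwK))).trans
          (Linked.of_adj (Or.inl hadj) hwK hw')⟩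
    have hA : ClosedOff (Arc f) (P.image (attach f)) A := by
      refine ⟨hcl.1.mono_left (Finset.filter_subset _ _), fun a ha b hbP hb => ?_⟩
      have haK := (Finset.mem_filter.1 ha).1
      by_cases hbK : b ∈ K
      · constructor
        · rintro ⟨i, rfl⟩
          exact hb (hstep ((a, i), false) ((a, i), true) ha hbK rfl)
        · rintro ⟨i, rfl⟩
          exact hb (hstep ((b, i), true) ((b, i), false) ha hbK rfl)
      · exact hcl.2 a haK b hbP hbK
    have hAK : A = K := core_eq_of_closedOff hr hc hA (Finset.filter_subset _ _)
      ⟨attach f u, Finset.mem_filter.2 ⟨hu, u, rfl, Linked.refl _ _ _⟩⟩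
    have hvA : attach f v ∈ A := hAK ▸ hv
    obtain ⟨-, w, hw, hl⟩ := Finset.mem_filter.1 hvA
    exact hl.trans (linked_of_attach_eq h1 h2 hw (by rw [hw]; exact hv))

end HalfEdge

/-- Graphs of maximum degree `3` and linear size with a haven of order `k`. -/
theorem exists_haven (k : ℕ) (hk : 1 ≤ k) :
    ∃ (U : Type) (_ : Fintype U) (_ : DecidableEq U) (B : SimpleGraph U),
      Fintype.card U = 160 * k ∧
      (∀ u, ∃ p q s, ∀ v, B.Adj u v → v = p ∨ v = q ∨ v = s) ∧ Nonempty (Haven B k) := by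
  have : Nonempty (Fin (4 * k)) := ⟨⟨0, by omega⟩⟩
  -- With 4k points, k cops delete at most a quarter; the number of half-edges is 4k · 20 · 2.
  obtain ⟨f, hf⟩ := exists_expanding (Fin (4 * k))
  obtain ⟨idx, h1, h2⟩ := exists_fibre_index (attach f)
  have hr : Spreads (Arc f) := fun A B hA hB => by
    obtain ⟨a, ha, i, hi⟩ := hf A B hA hB
    exact ⟨a, ha, _, hi, i, rfl⟩
  refine ⟨_, inferInstance, inferInstance, halfEdgeGraph f idx, ?_, halfEdgeGraph_degree h1,
    ⟨halfEdgeHaven hr h1 h2 (by simp) (by simp; omega)⟩⟩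
  simp
  ring

/-! ### Cai-Fürer-Immerman graphs: size, colour classes, VC dimension -/

/-- The vertices of the Cai-Fürer-Immerman graph over `B` with charges `c`, in which every vertex
is repeated `t` times. -/
@[ext]
structure CFIVertex {U : Type} [Fintype U] (B : SimpleGraph U) (c : U → ZMod 2) (t : ℕ) where
  base : U
  val : U → ZMod 2
  copy : Fin t
  adj_of_val_ne : ∀ v, val v ≠ 0 → B.Adj base v
  sum_val : ∑ v, val v = c base

section CFI

variable {U : Type} [Fintype U] {B : SimpleGraph U} {c c' : U → ZMod 2} {t : ℕ}

noncomputable instance : Fintype (CFIVertex B c t) := by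
  classical
  exact Fintype.ofInjective (fun x : CFIVertex B c t => (x.base, x.val, x.copy)) fun x y h => by
    simp only [Prod.mk.injEq] at h
    exact CFIVertex.ext h.1 h.2.1 h.2.2

/-- The Cai-Fürer-Immerman graph over `B` with charges `c`, in which every vertex is replaced by
`t` twins of different colours. -/
def cfiGraph (B : SimpleGraph U) (c : U → ZMod 2) (t : ℕ) :
    ColouredGraph (CFIVertex B c t) (U × Fin t) where
  graph :=
    { Adj := fun x y => B.Adj x.base y.base ∧ x.val y.base = y.val x.base
      symm := ⟨fun _ _ h => ⟨h.1.symm, h.2.symm⟩⟩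
      loopless := ⟨fun _ h => B.irrefl h.1⟩ }
  colour x := (x.base, x.copy)

/-- Adding `ψ u` to all vertices over `u`. -/
def cfiShift (ψ : U → U → ZMod 2) (h1 : ∀ u v, ψ u v ≠ 0 → B.Adj u v)
    (h2 : ∀ u, ∑ v, ψ u v = c u + c' u) : CFIVertex B c t ≃ CFIVertex B c' t where
  toFun x :=
    { base := x.base
      val := x.val + ψ x.base
      copy := x.copy
      adj_of_val_ne := fun v hv => by
        by_contra hB
        have e1 : x.val v = 0 := by_contra fun h => hB (x.adj_of_val_ne v h)
        have e2 : ψ x.base v = 0 := by_contra fun h => hB (h1 _ v h)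
        simp [e1, e2] at hv
      sum_val := by
        simp only [Pi.add_apply, Finset.sum_add_distrib, h2, x.sum_val]
        linear_combination CharTwo.add_self_eq_zero (c x.base) }
  invFun x :=
    { base := x.base
      val := x.val + ψ x.base
      copy := x.copy
      adj_of_val_ne := fun v hv => by
        by_contra hB
        have e1 : x.val v = 0 := by_contra fun h => hB (x.adj_of_val_ne v h)
        have e2 : ψ x.base v = 0 := by_contra fun h => hB (h1 _ v h)
        simp [e1, e2] at hv
      sum_val := by
        simp only [Pi.add_apply, Finset.sum_add_distrib, h2, x.sum_val]
        linear_combination CharTwo.add_self_eq_zero (c' x.base) }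
  left_inv x := by
    ext <;> simp [add_assoc, CharTwo.add_self_eq_zero]
  right_inv x := by
    ext <;> simp [add_assoc, CharTwo.add_self_eq_zero]

/-- Around a vertex with at most three neighbours, two values determine the third. -/
theorem cfi_val_eq {x y : CFIVertex B c t} {p q s : U} (hb : x.base = y.base)
    (hN : ∀ v, B.Adj x.base v → v = p ∨ v = q ∨ v = s) (hp : x.val p = y.val p)
    (hq : x.val q = y.val q) : x.val = y.val := by
  classical
  have hzero : ∀ v, v ≠ s → x.val v = y.val v := by
    intro v hv
    by_cases hB : B.Adj x.base v
    · rcases hN v hB with rfl | rfl | rfl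
      · exact hp
      · exact hq
      · exact absurd rfl hv
    · have e1 : x.val v = 0 := by_contra fun h => hB (x.adj_of_val_ne v h)
      have e2 : y.val v = 0 := by_contra fun h => hB (hb ▸ y.adj_of_val_ne v h)
      rw [e1, e2]
  have hsum : ∑ v, x.val v = ∑ v, y.val v := by rw [x.sum_val, y.sum_val, hb]
  rw [← Finset.add_sum_erase _ _ (Finset.mem_univ s),
    ← Finset.add_sum_erase _ y.val (Finset.mem_univ s),
    Finset.sum_congr rfl fun v hv => hzero v (Finset.ne_of_mem_erase hv)] at hsum
  funext v
  by_cases hv : v = s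
  · exact hv ▸ add_right_cancel hsum
  · exact hzero v hv

theorem cfi_val_eq_of_adj (hdeg : ∀ u, ∃ p q s, ∀ v, B.Adj u v → v = p ∨ v = q ∨ v = s)
    {x y : CFIVertex B c t} {p q : U} (hb : x.base = y.base) (hpq : p ≠ q)
    (hBp : B.Adj x.base p) (hBq : B.Adj x.base q) (hp : x.val p = y.val p)
    (hq : x.val q = y.val q) : x.val = y.val := by
  obtain ⟨a, b, d, h⟩ := hdeg x.base
  have hs : ∃ s, ∀ v, B.Adj x.base v → v = p ∨ v = q ∨ v = s := by
    rcases h p hBp with rfl | rfl | rfl <;> rcases h q hBq with rfl | rfl | rfl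
    · exact absurd rfl hpq
    · exact ⟨d, fun v hv => by have := h v hv; tauto⟩
    · exact ⟨b, fun v hv => by have := h v hv; tauto⟩
    · exact ⟨d, fun v hv => by have := h v hv; tauto⟩
    · exact absurd rfl hpq
    · exact ⟨a, fun v hv => by have := h v hv; tauto⟩
    · exact ⟨b, fun v hv => by have := h v hv; tauto⟩
    · exact ⟨a, fun v hv => by have := h v hv; tauto⟩
    · exact absurd rfl hpq
  obtain ⟨s, hs⟩ := hs
  exact cfi_val_eq hb hs hp hq

theorem cfi_exists_code (hdeg : ∀ u, ∃ p q s, ∀ v, B.Adj u v → v = p ∨ v = q ∨ v = s) :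
    ∃ code : CFIVertex B c t → ZMod 2 × ZMod 2,
      ∀ x y, x.base = y.base → x.copy = y.copy → code x = code y → x = y := by
  choose p q s h using hdeg
  refine ⟨fun x => (x.val (p x.base), x.val (q x.base)), fun x y hb hc hxy => ?_⟩
  simp only [Prod.mk.injEq] at hxy
  exact CFIVertex.ext hb
    (cfi_val_eq hb (h x.base) (by rw [hxy.1, hb]) (by rw [hxy.2, hb])) hc

theorem cfi_colourClass_ncard_le
    (hdeg : ∀ u, ∃ p q s, ∀ v, B.Adj u v → v = p ∨ v = q ∨ v = s) (d : U × Fin t) :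
    ((cfiGraph B c t).colourClass d).ncard ≤ 4 := by
  obtain ⟨code, hcode⟩ := cfi_exists_code (c := c) (t := t) hdeg
  have h := Set.ncard_le_ncard_of_injOn (s := (cfiGraph B c t).colourClass d)
    (t := (Set.univ : Set (ZMod 2 × ZMod 2))) code (fun _ _ => Set.mem_univ _) (by
      intro x hx y hy hxy
      have hxy' : (x.base, x.copy) = (y.base, y.copy) := Eq.trans hx (Eq.symm hy)
      simp only [Prod.mk.injEq] at hxy'
      exact hcode x y hxy'.1 hxy'.2 hxy)
  rw [Set.ncard_univ] at h
  simpa using h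

theorem cfi_card_le (hdeg : ∀ u, ∃ p q s, ∀ v, B.Adj u v → v = p ∨ v = q ∨ v = s) :
    Fintype.card (CFIVertex B c t) ≤ Fintype.card U * t * 4 := by
  obtain ⟨code, hcode⟩ := cfi_exists_code (c := c) (t := t) hdeg
  have h := Fintype.card_le_of_injective
    (fun x : CFIVertex B c t => ((x.base, x.copy), code x)) (by
      intro x y hxy
      simp only [Prod.mk.injEq] at hxy
      exact hcode x y hxy.1.1 hxy.1.2 hxy.2)
  simpa using h

/-- The vertex over `u` with value `0`. -/
@[simps]
def cfiZero (B : SimpleGraph U) {t : ℕ} (u : U) (i : Fin t) : CFIVertex B 0 t where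
  base := u
  val := 0
  copy := i
  adj_of_val_ne := by simp
  sum_val := by simp

theorem le_cfi_card : Fintype.card U * t ≤ Fintype.card (CFIVertex B 0 t) := by
  have h := Fintype.card_le_of_injective
    (fun x : U × Fin t => cfiZero B x.1 x.2) (by
      intro x y hxy
      exact Prod.ext (congrArg CFIVertex.base hxy) (congrArg CFIVertex.copy hxy))
  simpa using h

/-- Suppose that four vertices are shattered and `v` is adjacent to all. Their bases are among the
three neighbours of `v.base`, so two of them, `x` and `x'`, share a base. A common neighbour of both
must lie over `v.base` and agree with `v` towards `x.base`. A further `y` over the same base is then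
adjacent to all common neighbours of `x` and `x'`; a `y` over another base fixes a second value, so
that a neighbour of `x`, `x'`, `y` has the values of `v` and is adjacent to `z` too. -/
theorem cfi_vcDim_le (hdeg : ∀ u, ∃ p q s, ∀ v, B.Adj u v → v = p ∨ v = q ∨ v = s) :
    (cfiGraph B c t).vcDim ≤ 3 := by
  classical
  unfold ColouredGraph.vcDim Finset.vcDim
  refine Finset.sup_le fun X hX => ?_
  rw [Finset.mem_shatterer] at hX
  by_contra! hcard
  have htrace : ∀ Y ⊆ X, ∃ v : CFIVertex B c t, ∀ x ∈ X, (cfiGraph B c t).graph.Adj v x ↔ x ∈ Y := by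
    intro Y hY
    obtain ⟨N, hN, hXN⟩ := hX hY
    obtain ⟨v, -, rfl⟩ := Finset.mem_image.1 hN
    refine ⟨v, fun x hx => ?_⟩
    rw [← hXN]
    simp [hx]
  obtain ⟨v, hv⟩ := htrace X le_rfl
  have hvX : ∀ x ∈ X, B.Adj v.base x.base ∧ v.val x.base = x.val v.base := fun x hx =>
    (hv x hx).2 hx
  have hpigeon : ∃ x ∈ X, ∃ x' ∈ X, x ≠ x' ∧ x.base = x'.base := by
    obtain ⟨p, q, s, h⟩ := hdeg v.base
    refine Finset.exists_ne_map_eq_of_card_lt_of_maps_to (t := {p, q, s})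
      (lt_of_le_of_lt Finset.card_le_three hcard) fun x hx => ?_
    simpa using h _ (hvX x hx).1
  obtain ⟨x, hx, x', hx', hne, hb⟩ := hpigeon
  have hval : x.val ≠ x'.val := by
    intro hval
    obtain ⟨w, hw⟩ := htrace {x} (by simpa using hx)
    have h1 := (hw x hx).2 (by simp)
    have h2 : ¬ (cfiGraph B c t).graph.Adj w x' := by
      rw [hw x' hx']
      simpa using hne.symm
    refine h2 ⟨hb ▸ h1.1, ?_⟩
    rw [← hb, ← hval]
    exact h1.2
  have hbase : ∀ w : CFIVertex B c t, (cfiGraph B c t).graph.Adj w x →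
      (cfiGraph B c t).graph.Adj w x' → w.base = v.base ∧ w.val x.base = v.val x.base := by
    intro w h1 h2
    have e : x.val v.base = x'.val v.base := by
      rw [← (hvX x hx).2, ← (hvX x' hx').2, hb]
    have hwv : w.base = v.base := by
      by_contra hwv
      refine hval (cfi_val_eq_of_adj hdeg hb hwv h1.1.symm (hvX x hx).1.symm ?_ e)
      rw [← h1.2, ← h2.2, hb]
    exact ⟨hwv, by rw [h1.2, (hvX x hx).2, hwv]⟩
  obtain ⟨y, hy, z, hz, hyx, hyx', hzx, hzx', hyz⟩ : ∃ y ∈ X, ∃ z ∈ X,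
      y ≠ x ∧ y ≠ x' ∧ z ≠ x ∧ z ≠ x' ∧ y ≠ z := by
    have h2 : 1 < ((X.erase x).erase x').card := by
      rw [Finset.card_erase_of_mem (by simp [hx', hne.symm]), Finset.card_erase_of_mem hx]
      omega
    obtain ⟨y, hy, z, hz, hyz⟩ := Finset.one_lt_card.1 h2
    simp only [Finset.mem_erase] at hy hz
    exact ⟨y, hy.2.2, z, hz.2.2, hy.2.1, hy.1, hz.2.1, hz.1, hyz⟩
  have hyb : y.base ≠ x.base := by
    intro hyb
    obtain ⟨w, hw⟩ := htrace {x, x'} (by simp [Finset.insert_subset_iff, hx, hx'])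
    obtain ⟨e1, e2⟩ := hbase w ((hw x hx).2 (by simp)) ((hw x' hx').2 (by simp))
    have h2 : ¬ (cfiGraph B c t).graph.Adj w y := by
      rw [hw y hy]
      simp [hyx, hyx']
    refine h2 ⟨e1 ▸ (hvX y hy).1, ?_⟩
    rw [e1, hyb, e2, ← hyb]
    exact (hvX y hy).2
  obtain ⟨w, hw⟩ := htrace {x, x', y} (by simp [Finset.insert_subset_iff, hx, hx', hy])
  obtain ⟨e1, e2⟩ := hbase w ((hw x hx).2 (by simp)) ((hw x' hx').2 (by simp))
  have h1 := (hw y hy).2 (by simp)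
  have hwv : w.val = v.val := by
    refine cfi_val_eq_of_adj hdeg e1 hyb h1.1 (e1 ▸ (hvX x hx).1) ?_ e2
    rw [h1.2, e1, (hvX y hy).2]
  have h2 : ¬ (cfiGraph B c t).graph.Adj w z := by
    rw [hw z hz]
    simp [hzx, hzx', hyz.symm]
  refine h2 ⟨e1 ▸ (hvX z hz).1, ?_⟩
  rw [hwv, e1]
  exact (hvX z hz).2

theorem cfi_adj_iff {φ : U → U → ZMod 2} {x x' : CFIVertex B c t} {y y' : CFIVertex B c' t}
    (hφ : IsEdgeFunction B φ) (hb : y.base = x.base) (hb' : y'.base = x'.base)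
    (hv : y.val = x.val + φ x.base) (hv' : y'.val = x'.val + φ x'.base) :
    (cfiGraph B c t).graph.Adj x x' ↔ (cfiGraph B c' t).graph.Adj y y' := by
  simp only [cfiGraph, hb, hb', hv, hv', Pi.add_apply, hφ.1 x'.base x.base, add_left_inj]

theorem cfi_eq_iff {φ : U → U → ZMod 2} {x x' : CFIVertex B c t} {y y' : CFIVertex B c' t}
    (hb : y.base = x.base) (hb' : y'.base = x'.base)
    (hc : y.copy = x.copy) (hc' : y'.copy = x'.copy)
    (hv : y.val = x.val + φ x.base) (hv' : y'.val = x'.val + φ x'.base) :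
    x = x' ↔ y = y' := by
  rw [CFIVertex.ext_iff, CFIVertex.ext_iff, hb, hb', hc, hc', hv, hv']
  refine and_congr_right fun h => ?_
  rw [h, add_left_inj]

end CFI

/-! ### Edit distance by averaging over transversals -/

section EditDistance

variable {U : Type} [Fintype U] {B : SimpleGraph U} {c' : U → ZMod 2} {t : ℕ}

theorem sum_sum_eq_zero_of_symmetric {a : U → U → ZMod 2} (h : ∀ u v, a u v = a v u)
    (h0 : ∀ u, a u u = 0) : ∑ u, ∑ v, a u v = 0 := by
  classical
  rw [← Fintype.sum_prod_type']
  refine Finset.sum_involution (fun x _ => x.swap) (fun x _ => ?_) (fun x _ hx hs => ?_)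
    (fun _ _ => Finset.mem_univ _) (fun _ _ => Prod.swap_swap _)
  · simp [h x.2 x.1, CharTwo.add_self_eq_zero]
  · have : x.2 = x.1 := congrArg Prod.fst hs
    exact hx (by rw [this, h0])

theorem card_functions_two_values [DecidableEq U] {u v : U} (huv : u ≠ v) (i j : Fin t) :
    (Finset.univ.filter fun g : U → Fin t => g u = i ∧ g v = j).card * t ^ 2
      ≤ t ^ Fintype.card U := by
  have h := Finset.card_le_card_of_injOn
    (s := (Finset.univ.filter fun g : U → Fin t => g u = i ∧ g v = j) ×ˢ
      (Finset.univ : Finset (Fin t × Fin t))) (t := (Finset.univ : Finset (U → Fin t)))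
    (fun x => Function.update (Function.update x.1 u x.2.1) v x.2.2)
    (fun _ _ => Finset.mem_coe.2 (Finset.mem_univ _)) (by
      rintro ⟨g, i₁, j₁⟩ hg ⟨g', i₂, j₂⟩ hg' h
      simp only [Finset.coe_product, Set.mem_prod, Finset.mem_coe, Finset.mem_filter,
        Finset.mem_univ, true_and, and_true] at hg hg'
      have hj : j₁ = j₂ := by simpa using congrFun h v
      have hi : i₁ = i₂ := by simpa [huv] using congrFun h u
      have hgg : g = g' := by
        funext w
        by_cases hw : w = u
        · rw [hw, hg.1, hg'.1]
        · by_cases hw' : w = v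
          · rw [hw', hg.2, hg'.2]
          · simpa [hw, hw'] using congrFun h w
      rw [hi, hj, hgg])
  simpa [pow_two] using h

theorem le_editCost_cfi (hodd : ∑ u, c' u = 1) (π : CFIVertex B 0 t ≃ CFIVertex B c' t)
    (hπ : ∀ x, (cfiGraph B c' t).colour (π x) = (cfiGraph B 0 t).colour x) :
    t ^ 2 ≤ (cfiGraph B 0 t).editCost (cfiGraph B c' t) π := by
  classical
  have hbase : ∀ x, (π x).base = x.base := fun x => congrArg Prod.fst (hπ x)
  let bad : Set (Sym2 (CFIVertex B c' t)) :=
    (Sym2.map π '' (cfiGraph B 0 t).graph.edgeSet) \ (cfiGraph B c' t).graph.edgeSet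
  have hbad : bad.ncard ≤ (cfiGraph B 0 t).editCost (cfiGraph B c' t) π :=
    Set.ncard_le_ncard (fun e he => Or.inl he) (Set.toFinite _)
  refine le_trans ?_ hbad
  let hit : Sym2 (CFIVertex B c' t) → Finset (U → Fin t) := fun e =>
    Finset.univ.filter fun g => ∃ u v, u ≠ v ∧
      e = s(π (cfiZero B u (g u)), π (cfiZero B v (g v)))
  have hcover : (Finset.univ : Finset (U → Fin t)) ⊆ bad.toFinset.biUnion hit := by
    intro g _
    let a : U → U → ZMod 2 := fun u => (π (cfiZero B u (g u))).val
    -- If no edge of the transversal were broken, `a` would be symmetric with zero diagonal, so its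
    -- total sum would be 0; but it is the sum of the charges `c'`.
    have hpair : ∃ u v, B.Adj u v ∧ a u v ≠ a v u := by
      by_contra! hcon
      have hzero : ∀ u v, ¬ B.Adj u v → a u v = 0 := fun u v h => by
        by_contra hne
        exact h (by simpa [hbase] using (π (cfiZero B u (g u))).adj_of_val_ne v hne)
      have hsum := sum_sum_eq_zero_of_symmetric (a := a) (fun u v => by
        by_cases h : B.Adj u v
        · exact hcon u v h
        · rw [hzero u v h, hzero v u fun h' => h h'.symm]) fun u => hzero u u (B.irrefl)
      have hsum' : ∑ u, ∑ v, a u v = ∑ u, c' u := Finset.sum_congr rfl fun u _ => by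
        simpa [hbase] using (π (cfiZero B u (g u))).sum_val
      rw [hsum, hodd] at hsum'
      exact zero_ne_one hsum'
    obtain ⟨u, v, huv, hne⟩ := hpair
    refine Finset.mem_biUnion.2 ⟨s(π (cfiZero B u (g u)), π (cfiZero B v (g v))), ?_,
      Finset.mem_filter.2 ⟨Finset.mem_univ _, u, v, huv.ne, rfl⟩⟩
    rw [Set.mem_toFinset]
    refine ⟨⟨s(cfiZero B u (g u), cfiZero B v (g v)), ⟨huv, rfl⟩, rfl⟩, fun h => hne ?_⟩
    have h2 := (show (cfiGraph B c' t).graph.Adj _ _ from h).2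
    rw [hbase, hbase] at h2
    exact h2
  have hhit : ∀ e ∈ bad.toFinset, (hit e).card * t ^ 2 ≤ t ^ Fintype.card U := by
    intro e _
    by_cases hne : (hit e).Nonempty
    · obtain ⟨g, hg⟩ := hne
      obtain ⟨-, u, v, huv, he⟩ := Finset.mem_filter.1 hg
      refine le_trans (Nat.mul_le_mul_right _ (Finset.card_le_card ?_))
        (card_functions_two_values huv (g u) (g v))
      -- The ends of `e` reveal their bases and copies, so all transversals through `e` agree at `u`
      -- and `v`.
      intro g' hg'
      obtain ⟨-, u', v', -, he'⟩ := Finset.mem_filter.1 hg'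
      refine Finset.mem_filter.2 ⟨Finset.mem_univ _, ?_⟩
      rw [he, Sym2.eq_iff] at he'
      simp only [EmbeddingLike.apply_eq_iff_eq] at he'
      rcases he' with ⟨h1, h2⟩ | ⟨h1, h2⟩
      all_goals
        have b1 := congrArg CFIVertex.base h1
        have b2 := congrArg CFIVertex.base h2
        have c1 := congrArg CFIVertex.copy h1
        have c2 := congrArg CFIVertex.copy h2
        simp only [cfiZero_base, cfiZero_copy] at b1 b2 c1 c2
        subst b1 b2
        exact ⟨c1.symm, c2.symm⟩
    · rw [Finset.not_nonempty_iff_eq_empty.1 hne]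
      simp
  rcases Nat.eq_zero_or_pos t with rfl | ht
  · simp
  have h1 := (Finset.card_le_card hcover).trans Finset.card_biUnion_le
  rw [Finset.card_univ, Fintype.card_fun, Fintype.card_fin] at h1
  have h2 : t ^ 2 * t ^ Fintype.card U ≤ bad.ncard * t ^ Fintype.card U := by
    calc t ^ 2 * t ^ Fintype.card U ≤ t ^ 2 * ∑ e ∈ bad.toFinset, (hit e).card := by gcongr
      _ = ∑ e ∈ bad.toFinset, (hit e).card * t ^ 2 := by rw [mul_comm, Finset.sum_mul]
      _ ≤ ∑ e ∈ bad.toFinset, t ^ Fintype.card U := Finset.sum_le_sum hhit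
      _ = bad.ncard * t ^ Fintype.card U := by
        rw [Finset.sum_const, smul_eq_mul, Set.ncard_eq_toFinset_card']
  exact Nat.le_of_mul_le_mul_right h2 (by positivity)

end EditDistance

/-! ### Indistinguishability by Weisfeiler-Leman -/

section WeisfeilerLeman

variable {U : Type} [Fintype U] [DecidableEq U] {B : SimpleGraph U} {k t : ℕ} {r₀ : U}

/-- Adding `φ` turns the zero charges into the charge `1` at `r₀`, except for a defect at a vertex
where the robber can be when the cops are at `P`. -/
def Haven.Defect (R : Haven B k) (r₀ : U) (P : Finset U) (φ : U → U → ZMod 2) : Prop :=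
  IsEdgeFunction B φ ∧ ∃ r ∈ R.region P,
    ∀ u, ∑ v, φ u v = (Pi.single r₀ 1 + Pi.single r 1 : U → ZMod 2) u

variable {R : Haven B (k + 1)} {P Q : Finset U} {φ : U → U → ZMod 2}

theorem Haven.Defect.mono (h : R.Defect r₀ Q φ) (hPQ : P ⊆ Q) (hQ : Q.card ≤ k + 1) :
    R.Defect r₀ P φ := by
  obtain ⟨h1, r, hr, h2⟩ := h
  exact ⟨h1, r, R.antitone P Q hPQ hQ hr, h2⟩

theorem Haven.Defect.sum_row (h : R.Defect r₀ P φ) (hP : P.card ≤ k + 1) {u : U} (hu : u ∈ P) :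
    ∑ v, φ u v = (Pi.single r₀ 1 : U → ZMod 2) u := by
  obtain ⟨-, r, hr, h2⟩ := h
  have hne : u ≠ r := fun h => R.notMem P hP r hr (h ▸ hu)
  rw [h2, Pi.add_apply, Pi.single_eq_of_ne hne, add_zero]

theorem Haven.exists_defect (hr₀ : r₀ ∈ R.region ∅) (hP : P.card ≤ k + 1) :
    ∃ φ, R.Defect r₀ P φ := by
  obtain ⟨r, hr⟩ := R.nonempty P hP
  obtain ⟨φ, h1, -, h3⟩ := R.linked ∅ (by simp) r₀ hr₀ r
    (R.antitone ∅ P (Finset.empty_subset _) hP hr)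
  exact ⟨φ, h1, r, hr, h3⟩

/-- When cops are added, the robber moves from `r` to `s` inside the old region. The flow along this
move vanishes at the old cops, so nothing changes there. -/
theorem Haven.Defect.extend (h : R.Defect r₀ P φ) (hPQ : P ⊆ Q) (hQ : Q.card ≤ k + 1) :
    ∃ φ', R.Defect r₀ Q φ' ∧ ∀ p ∈ P, φ' p = φ p := by
  obtain ⟨h1, r, hr, h2⟩ := h
  have hP := (Finset.card_le_card hPQ).trans hQ
  obtain ⟨s, hs⟩ := R.nonempty Q hQ
  obtain ⟨ψ, k1, k2, k3⟩ := R.linked P hP r hr s (R.antitone P Q hPQ hQ hs)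
  refine ⟨φ + ψ, ⟨h1.add k1, s, hs, fun u => ?_⟩, fun p hp => ?_⟩
  · simp only [Pi.add_apply, Finset.sum_add_distrib, h2, k3]
    linear_combination CharTwo.add_self_eq_zero ((Pi.single r 1 : U → ZMod 2) u)
  · have hψ : ψ p = 0 := by
      funext v
      by_contra hv
      exact R.notMem P hP p (k2 p v hv) hp
    rw [Pi.add_apply, hψ, add_zero]

/-- For a fixed position of the cops, a bijection between the two Cai-Fürer-Immerman graphs that
extends the given shift over every single additional vertex. -/
theorem Haven.Defect.exists_equiv (h : R.Defect r₀ P φ) (hP : P.card ≤ k) :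
    ∃ e : CFIVertex B 0 t ≃ CFIVertex B (Pi.single r₀ 1) t, ∀ w,
      (e w).base = w.base ∧ (e w).copy = w.copy ∧
      ∃ φ', R.Defect r₀ (insert w.base P) φ' ∧ (∀ p ∈ P, φ' p = φ p) ∧
        (e w).val = w.val + φ' w.base := by
  have hQ : ∀ u, (insert u P).card ≤ k + 1 := fun u =>
    (Finset.card_insert_le _ _).trans (by omega)
  choose Φ h1 h2 using fun u => h.extend (Finset.subset_insert u P) (hQ u)
  -- The vertices over `u` are shifted by the flow chosen for the cop move to `u`. Since this flow
  -- varies with `u`, the result is a bijection but need not be an isomorphism.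
  refine ⟨cfiShift (fun u => Φ u u) (fun u v hv => (h1 u).1.2 u v hv) (fun u => ?_), fun w =>
    ⟨rfl, rfl, Φ w.base, h1 _, h2 _, rfl⟩⟩
  rw [(h1 u).sum_row (hQ u) (Finset.mem_insert_self _ _), Pi.zero_apply, zero_add]

/-- The tuple `y` arises from `x` by a shift with a defect away from the tuples. -/
def Haven.Similar (R : Haven B (k + 1)) (r₀ : U) (x : Fin k → CFIVertex B 0 t)
    (y : Fin k → CFIVertex B (Pi.single r₀ 1) t) : Prop :=
  ∃ φ, R.Defect r₀ (Finset.univ.image fun j => (x j).base) φ ∧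
    ∀ j, (y j).base = (x j).base ∧ (y j).copy = (x j).copy ∧
      (y j).val = (x j).val + φ (x j).base

theorem Haven.Similar.wl_eq {x : Fin k → CFIVertex B 0 t}
    {y : Fin k → CFIVertex B (Pi.single r₀ 1) t} (h : R.Similar r₀ x y) (i : ℕ) :
    (cfiGraph B 0 t).wl k i x = (cfiGraph B (Pi.single r₀ 1) t).wl k i y := by
  classical
  induction i generalizing x y with
  | zero =>
    obtain ⟨φ, ⟨hφ, -⟩, hy⟩ := h
    refine Prod.ext ?_ (Prod.ext ?_ ?_)
    · funext a b
      exact propext (cfi_eq_iff (hy a).1 (hy b).1 (hy a).2.1 (hy b).2.1 (hy a).2.2 (hy b).2.2)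
    · funext a b
      exact propext (cfi_adj_iff hφ (hy a).1 (hy b).1 (hy a).2.2 (hy b).2.2)
    · funext a
      exact Prod.ext (hy a).1.symm (hy a).2.1.symm
  | succ i ih =>
    refine Prod.ext (ih h) ?_
    obtain ⟨φ, hφ, hy⟩ := h
    have hcard : (Finset.univ.image fun j => (x j).base).card ≤ k :=
      Finset.card_image_le.trans (by simp)
    have hmem : ∀ j, (x j).base ∈ Finset.univ.image fun j => (x j).base := fun j =>
      Finset.mem_image_of_mem _ (Finset.mem_univ j)
    obtain ⟨e, he⟩ := hφ.exists_equiv (t := t) hcard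
    -- Relevant for k = 1: one edge function `φ'` shifts both the tuple and `w`, so adjacency
    -- between them is kept.
    have hrange : ∀ w, w ∈ (cfiGraph B 0 t).wlRange k x ↔
        e w ∈ (cfiGraph B (Pi.single r₀ 1) t).wlRange k y := by
      intro w
      obtain ⟨hb, -, φ', hφ', hag, hv⟩ := he w
      unfold ColouredGraph.wlRange
      split_ifs
      · simp only [Finset.mem_filter, Finset.mem_univ, true_and]
        refine forall_congr' fun j => cfi_adj_iff hφ'.1 (hy j).1 hb ?_ hv
        rw [(hy j).2.2, hag _ (hmem j)]
      · simp
    refine Multiset.map_eq_map_of_bij_of_nodup _ _ (Finset.nodup _) (Finset.nodup _)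
      (fun w _ => e w) (fun w hw => (hrange w).1 hw) (fun _ _ _ _ h => e.injective h)
      (fun z hz => ⟨e.symm z, (hrange _).2 (by simpa using hz), e.apply_symm_apply z⟩) ?_
    intro w _
    funext j
    obtain ⟨hb, hc, φ', hφ', hag, hv⟩ := he w
    -- The cop at the replaced entry may be lifted, which only enlarges the region of the robber.
    refine ih ⟨φ', hφ'.mono ?_ ((Finset.card_insert_le _ _).trans (by omega)), fun l => ?_⟩
    · intro u hu
      obtain ⟨l, -, rfl⟩ := Finset.mem_image.1 hu
      by_cases hl : l = j
      · subst hl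
        simp
      · rw [Function.update_of_ne hl]
        exact Finset.mem_insert_of_mem (hmem l)
    · by_cases hl : l = j
      · subst hl
        simpa using ⟨hb, hc, hv⟩
      · rw [Function.update_of_ne hl, Function.update_of_ne hl]
        exact ⟨(hy l).1, (hy l).2.1, by rw [(hy l).2.2, hag _ (hmem l)]⟩

/-- The shift of a tuple depends only on its bases, which are preserved; hence the map on tuples can
be inverted. Being a bijection, it gives equal colour counts. -/
theorem Haven.exists_similar_equiv (R : Haven B (k + 1)) (hr₀ : r₀ ∈ R.region ∅) :
    ∃ T : (Fin k → CFIVertex B 0 t) ≃ (Fin k → CFIVertex B (Pi.single r₀ 1) t),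
      ∀ x, R.Similar r₀ x (T x) := by
  have hcard : ∀ p : Fin k → U, (Finset.univ.image p).card ≤ k := fun p =>
    Finset.card_image_le.trans (by simp)
  choose φ hφ using fun p : Fin k → U =>
    R.exists_defect hr₀ ((hcard p).trans (Nat.le_succ k))
  choose e he using fun p => (hφ p).exists_equiv (t := t) (hcard p)
  have hsymm : ∀ p w, ((e p).symm w).base = w.base := fun p w => by
    rw [← (he p _).1, Equiv.apply_symm_apply]
  refine ⟨⟨fun x j => e (fun j => (x j).base) (x j),
    fun y j => (e fun j => (y j).base).symm (y j), fun x => ?_, fun y => ?_⟩, fun x =>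
    ⟨φ fun j => (x j).base, hφ _, fun j => ?_⟩⟩
  · simp only [(he _ _).1, Equiv.symm_apply_apply]
  · simp only [hsymm, Equiv.apply_symm_apply]
  · obtain ⟨hb, hc, φ', -, hag, hv⟩ := he (fun j => (x j).base) (x j)
    refine ⟨hb, hc, ?_⟩
    rw [← hag _ (Finset.mem_image_of_mem _ (Finset.mem_univ j))]
    exact hv

theorem not_wlDistinguishes_cfi (R : Haven B (k + 1)) (hr₀ : r₀ ∈ R.region ∅) :
    ¬ ColouredGraph.WLDistinguishes k (cfiGraph B 0 t) (cfiGraph B (Pi.single r₀ 1) t) := by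
  rintro ⟨i, c, h⟩
  obtain ⟨T, hT⟩ := R.exists_similar_equiv (t := t) hr₀
  refine h ?_
  rw [← Set.ncard_image_of_injective _ T.injective]
  congr 1
  ext y
  constructor
  · rintro ⟨x, hx, rfl⟩
    exact ((hT x).wl_eq i).symm.trans hx
  · intro hy
    refine ⟨T.symm y, ((hT _).wl_eq i).trans ?_, T.apply_symm_apply y⟩
    rwa [T.apply_symm_apply]

end WeisfeilerLeman

/-! ### Choice of parameters -/

theorem mainTheorem9 :
    ∃ c₁ c₂ : ℝ, 0 < c₁ ∧ 0 < c₂ ∧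
      ∀ k n : ℕ, 1 ≤ k → k ≤ n →
        ∃ (V W C : Type) (_ : Fintype V) (_ : Fintype W) (_ : Fintype C)
          (G : ColouredGraph V C) (H : ColouredGraph W C),
          ¬ G.Isomorphic H ∧
          Fintype.card V = Fintype.card W ∧
          c₁ * (n : ℝ) ≤ (Fintype.card V : ℝ) ∧ (Fintype.card V : ℝ) ≤ c₂ * (n : ℝ) ∧
          ¬ ColouredGraph.WLDistinguishes k G H ∧
          (n : ℝ) ^ 2 / (k : ℝ) ^ 2 ≤ (G.editDist H : ℝ) ∧
          G.vcDim ≤ 3 ∧ H.vcDim ≤ 3 ∧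
          (∀ c, (G.colourClass c).ncard ≤ 4) ∧ (∀ c, (H.colourClass c).ncard ≤ 4) := by
  refine ⟨1, 2560, by norm_num, by norm_num, fun k n hk hkn => ?_⟩
  -- Order k+1 leaves one cop for the vertex added in a refinement step.
  obtain ⟨U, _, _, B, hU, hdeg, ⟨R⟩⟩ := exists_haven (k + 1) (by omega)
  obtain ⟨r₀, hr₀⟩ := R.nonempty ∅ (by simp)
  set t := n / k + 1 with ht
  have htn : n < k * t := Nat.lt_mul_div_succ n hk
  have htn' : k * t ≤ 2 * n := by
    have := Nat.mul_div_le n k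
    rw [ht, mul_add]
    omega
  obtain ⟨φ, hφ⟩ := R.exists_defect hr₀ (P := ∅) (by simp)
  obtain ⟨e, he⟩ := hφ.exists_equiv (t := t) (by simp)
  have hodd : ∑ u, (Pi.single r₀ 1 : U → ZMod 2) u = 1 := by simp
  have hedit : t ^ 2 ≤ (cfiGraph B 0 t).editDist (cfiGraph B (Pi.single r₀ 1) t) := by
    -- The bijection `e` rules out the default value 0 of the infimum.
    refine le_csInf ⟨_, e, fun v => Prod.ext (he v).1 (he v).2.1, rfl⟩ ?_
    rintro _ ⟨π, hπ, rfl⟩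
    exact le_editCost_cfi hodd π hπ
  refine ⟨_, _, _, inferInstance, inferInstance, inferInstance, cfiGraph B 0 t,
    cfiGraph B (Pi.single r₀ 1) t, ?_, Fintype.card_congr e, ?_, ?_,
    not_wlDistinguishes_cfi R hr₀, ?_, cfi_vcDim_le hdeg, cfi_vcDim_le hdeg,
    cfi_colourClass_ncard_le hdeg, cfi_colourClass_ncard_le hdeg⟩
  · rintro ⟨π, hπ⟩
    have h := le_editCost_cfi hodd π.toEquiv hπ
    have h0 : (cfiGraph B 0 t).editCost (cfiGraph B (Pi.single r₀ 1) t) π.toEquiv = 0 := by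
      unfold ColouredGraph.editCost
      have himage : Sym2.map π.toEquiv '' (cfiGraph B 0 t).graph.edgeSet
          = (cfiGraph B (Pi.single r₀ 1) t).graph.edgeSet := by
        ext z
        constructor
        · rintro ⟨z, hz, rfl⟩
          induction z with | _ a b => exact π.map_rel_iff.2 hz
        · intro hz
          induction z with | _ a b =>
          exact ⟨s(π.symm a, π.symm b), π.symm.map_rel_iff.2 hz, by simp⟩
      rw [himage, symmDiff_self]
      simp
    rw [h0] at h
    have : 0 < t ^ 2 := by positivity
    omega
  · have h := le_cfi_card (B := B) (t := t)
    rw [hU] at h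
    have h' : n ≤ Fintype.card (CFIVertex B 0 t) := by nlinarith
    rw [one_mul]
    exact_mod_cast h'
  -- Here 160(k+1) · t · 4 ≤ 1280kt ≤ 2560n, using k+1 ≤ 2k and kt ≤ 2n.
  · have h := cfi_card_le (c := 0) (t := t) hdeg
    rw [hU] at h
    have h' : Fintype.card (CFIVertex B 0 t) ≤ 2560 * n := by nlinarith
    exact_mod_cast h'
  · rw [← div_pow]
    have hkpos : (0 : ℝ) < k := by exact_mod_cast hk
    have h1 : (n : ℝ) / k ≤ t := by
      rw [div_le_iff₀ hkpos, mul_comm]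
      exact_mod_cast htn.le
    calc ((n : ℝ) / k) ^ 2 ≤ (t : ℝ) ^ 2 := by gcongr
      _ ≤ _ := by exact_mod_cast hedit
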